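/- For integers $r,n\ge 1$ and a sign $\sigma\in\{1,-1\}$ put $H_n^{(r;\sigma)}=\sum_{k=1}^n \sigma^{k-1}/k^r$, so that $\sigma=1$ gives the generalized harmonic numbers $H_n^{(r)}$ and $\sigma=-1$ the alternating harmonic numbers $\bar H_n^{(r)}$. For integers $i_1,\dots,i_m,q\ge1$ and signs $\sigma_1,\dots,\sigma_{m+1}\in\{1,-1\}$ with $(q,\sigma_{m+1})\ne(1,1)$, the (alternating) Euler sum is $$S(i_1,\dots,i_m,q;\sigma_1,\dots,\sigma_{m+1})=\sum_{n=1}^\infty \sigma_{m+1}^{\,n-1}\,\frac{H_n^{(i_1;\sigma_1)}\cdots H_n^{(i_m;\sigma_m)}}{n^q},$$ and for integers $s_1,\dots,s_k\ge1$ and signs with $(s_1,\sigma_1)\neq(1,1)$ the alternating multiple zeta value is $$\zeta(s_1,\dots,s_k;\sigma_1,\dots,\sigma_k)=\lim_{n\to\infty}\ \sum_{n\ge n_1>n_2>\cdots>n_k\ge1}\frac{\sigma_1^{n_1}\cdots\sigma_k^{n_k}}{n_1^{s_1}\cdots n_k^{s_k}}$$ (the series being understood as the limit of its partial sums). An exponent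 with sign $-1$ is also written with a bar, e.g. $\zeta(\bar s)=\zeta(s;-1)$, $S_{\bar r,2r}=S(r,2r;-1,1)$ and $S_{\bar r^2,\bar r}=S(r,r,r;-1,-1,-1)$. **Corollary.** (1) For all integers $i_1,i_2,q\ge1$ and all signs $\sigma_1,\sigma_2,\sigma_3\in\{1,-1\}$ with $(q,\sigma_3)\ne(1,1)$, all the limits below exist and $$\begin{aligned}S(i_1,i_2,q;\sigma_1,\sigma_2,\sigma_3)=\sigma_1\sigma_2\sigma_3\bigl\{&\zeta(q,i_1+i_2;\sigma_3,\sigma_1\sigma_2)+\zeta(q+i_1+i_2;\sigma_1\sigma_2\sigma_3)\\&+\zeta(q,i_1,i_2;\sigma_3,\sigma_1,\sigma_2)+\zeta(q+i_1,i_2;\sigma_1\sigma_3,\sigma_2)\\&+\zeta(q,i_2,i_1;\sigma_3,\sigma_2,\sigma_1)+\zeta(q+i_2,i_1;\sigma_2\sigma_3,\sigma_1)\bigr\}.\end{aligned}$$ (2) For every integer $r\ge1$, all the limits below exist and $$S_{\bar r^2,\bar r}=S_{\bar r,2r}+\tfrac13\bigl\{\zeta(\overline{3r})-\zeta(\bar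 r)^3\bigr\}.$$ (3) For every odd integer $r\ge1$, the sum $S_{\bar r^2,\bar r}$ is expressible in terms of (alternating) zeta values: it is a polynomial with rational coefficients in the numbers $\zeta(s)$, $s\ge2$, and $\zeta(\bar s)$, $s\ge1$. -/

import Mathlib

open Filter Topology

noncomputable section

namespace EulerSums

/-- Signs are elements of `ℤˣ = {1, -1}`. A string of exponents and signs
`(s₁, …, s_k; σ₁, …, σ_k)` is the list `[(s₁, σ₁), …, (s_k, σ_k)]`; the barred exponent `s̄` is
`(s, -1)` and the unbarred exponent `s` is `(s, 1)`. -/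
abbrev SignedIndex : Type := List (ℕ × ℤˣ)

/-- The alternating multiple harmonic sum
`ζ_n(s₁, …, s_k; σ₁, …, σ_k) = ∑_{n ≥ n₁ > n₂ > ⋯ > n_k ≥ 1} ∏_j σ_j ^ n_j / n_j ^ s_j`,
with value `1` for the empty string, computed by summing over the largest variable `n₁ = m`:
the remaining variables then satisfy `m - 1 ≥ n₂ > ⋯ > n_k ≥ 1`. -/
def altMHS : SignedIndex → ℕ → ℝ
  | [], _ => 1
  | (s, σ) :: l, n =>
      ∑ m ∈ Finset.Icc 1 n, ((σ : ℤ) : ℝ) ^ m / (m : ℝ) ^ s * altMHS l (m - 1)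

/-- The limit that defines the alternating multiple zeta value exists. -/
def AltMZVConverges (l : SignedIndex) : Prop :=
  ∃ x : ℝ, Tendsto (altMHS l) atTop (𝓝 x)

/-- The alternating multiple zeta value
`ζ(s₁, …, s_k; σ₁, …, σ_k) = lim_{n → ∞} ζ_n(s₁, …, s_k; σ₁, …, σ_k)`. -/
def altMZV (l : SignedIndex) : ℝ :=
  limUnder atTop (altMHS l)

/-- `∑_{k=1}^n σ ^ (k - 1) / k ^ r`: the generalized harmonic number `H_n^{(r)}` for `σ = 1` and
the alternating harmonic number, with summand `(-1) ^ (k - 1) / k ^ r`, for `σ = -1`. -/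
def signedHarmonic (r : ℕ) (σ : ℤˣ) (n : ℕ) : ℝ :=
  ∑ k ∈ Finset.Icc 1 n, ((σ : ℤ) : ℝ) ^ (k - 1) / (k : ℝ) ^ r

/-- The partial sum over `1 ≤ n ≤ N` of the (alternating) Euler sum
`S(i₁, …, i_m, q; σ₁, …, σ_m, τ)`, whose `n`-th term is `τ ^ (n - 1) / n ^ q` times the product of
the (alternating) harmonic numbers of order `i_j` and sign `σ_j`; the list is
`[(i₁, σ₁), …, (i_m, σ_m)]`. -/
def eulerPartialSum (l : SignedIndex) (q : ℕ) (τ : ℤˣ) (N : ℕ) : ℝ :=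
  ∑ n ∈ Finset.Icc 1 N, ((τ : ℤ) : ℝ) ^ (n - 1) *
    (l.map fun p => signedHarmonic p.1 p.2 n).prod / (n : ℝ) ^ q

/-- The series of the (alternating) Euler sum converges (possibly only conditionally). -/
def EulerSumConverges (l : SignedIndex) (q : ℕ) (τ : ℤˣ) : Prop :=
  ∃ x : ℝ, Tendsto (eulerPartialSum l q τ) atTop (𝓝 x)

/-- The (alternating) Euler sum `S(i₁, …, i_m, q; σ₁, …, σ_m, τ)`, as the limit of its partial
sums: for `q = 1` and `τ = -1` the series need not converge absolutely. -/
def eulerSum (l : SignedIndex) (q : ℕ) (τ : ℤˣ) : ℝ :=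
  limUnder atTop (eulerPartialSum l q τ)

/-- The set of the zeta values `ζ(s)`, `s ≥ 2`, and the alternating zeta values `ζ(s̄)`, `s ≥ 1`. -/
def altZetaValues : Set ℝ :=
  {x | ∃ (s : ℕ) (σ : ℤˣ), 1 ≤ s ∧ (s, σ) ≠ (1, 1) ∧ x = altMZV [(s, σ)]}

end EulerSums

end

open EulerSums

namespace EulerSums

/-! The first two statements already hold between partial sums, for every `n`, and pass to the
limit. Expanding a product of two harmonic sums by quasi-shuffle gives the six-term formula
(`eulerPartialSum_quadratic`); telescoping the cube of the alternating harmonic sum gives the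
reduction (`eulerPartialSum_cube`). Existence of the limits is `altMZVConverges_cons`: a harmonic
sum grows at most like `√n`, so an outer exponent at least 2 gives absolute convergence, and an
outer `1` with a bar is handled by Abel summation.

For odd `r` it remains to evaluate `ζ(2r, r̄)`. Sum `(-1)^(k-m) / ((k-m)^r m^(2r))` over `k ≥ 1` and
integers `m ≠ 0, k`. With `m` innermost, partial fractions lower the two exponents until one
vanishes, which leaves products of zeta values (`tornheimReducible`). With `k` innermost, the sum
telescopes, and since `r` is odd the contributions of `m` and `-m` reinforce each other, giving
`2ζ(r̄)ζ(2r) - 2ζ(2r, r̄) - ζ(3r̄)` (`tendsto_sum_of_tendsto_symSum`). Equating the two solves for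
`ζ(2r, r̄)`. -/

lemma sum_Icc_one_eq_sum_range (f : ℕ → ℝ) (n : ℕ) :
    ∑ m ∈ Finset.Icc 1 n, f m = ∑ m ∈ Finset.range n, f (m + 1) := by
  induction n with
  | zero => simp
  | succ n ih => rw [Finset.sum_Icc_succ_top (by omega), Finset.sum_range_succ, ih]

lemma altMHS_zero (p : ℕ × ℤˣ) (l : SignedIndex) : altMHS (p :: l) 0 = 0 := by
  simp [altMHS]

lemma altMHS_succ (s : ℕ) (σ : ℤˣ) (l : SignedIndex) (n : ℕ) :
    altMHS ((s, σ) :: l) (n + 1) = altMHS ((s, σ) :: l) n +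
      ((σ : ℤ) : ℝ) ^ (n + 1) / ((n + 1 : ℕ) : ℝ) ^ s * altMHS l n := by
  simp only [altMHS]
  rw [Finset.sum_Icc_succ_top (by omega)]
  simp

lemma altMHS_eq_sum_range (s : ℕ) (σ : ℤˣ) (l : SignedIndex) (n : ℕ) :
    altMHS ((s, σ) :: l) n =
      ∑ m ∈ Finset.range n, ((σ : ℤ) : ℝ) ^ (m + 1) / ((m + 1 : ℕ) : ℝ) ^ s * altMHS l m := by
  simp only [altMHS]
  rw [sum_Icc_one_eq_sum_range]
  simp

lemma altMHS_singleton (s : ℕ) (σ : ℤˣ) (n : ℕ) :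
    altMHS [(s, σ)] n = ∑ m ∈ Finset.range n, ((σ : ℤ) : ℝ) ^ (m + 1) / ((m + 1 : ℕ) : ℝ) ^ s := by
  rw [altMHS_eq_sum_range]
  simp [altMHS]

lemma abs_sign (σ : ℤˣ) : |((σ : ℤ) : ℝ)| = 1 := by
  rcases Int.units_eq_one_or σ with rfl | rfl <;> simp

lemma sign_mul_self (σ : ℤˣ) : ((σ : ℤ) : ℝ) * ((σ : ℤ) : ℝ) = 1 := by
  rcases Int.units_eq_one_or σ with rfl | rfl <;> simp

/-! ### Growth of harmonic sums and convergence. -/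

lemma sqrt_add_inv_sqrt_le (n : ℕ) : √((n : ℝ) + 1) + 1 / (2 * √((n : ℝ) + 2)) ≤ √((n : ℝ) + 2) := by
  have h1 : 0 < √((n : ℝ) + 1) := Real.sqrt_pos.2 (by positivity)
  have h2 : 0 < √((n : ℝ) + 2) := Real.sqrt_pos.2 (by positivity)
  have h3 : √((n : ℝ) + 1) ^ 2 = n + 1 := Real.sq_sqrt (by positivity)
  have h4 : √((n : ℝ) + 2) ^ 2 = n + 2 := Real.sq_sqrt (by positivity)
  rw [← sub_nonneg]
  have : √((n : ℝ) + 2) - (√((n : ℝ) + 1) + 1 / (2 * √((n : ℝ) + 2))) =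
      (√((n : ℝ) + 2) - √((n : ℝ) + 1)) ^ 2 / (2 * √((n : ℝ) + 2)) := by
    field_simp
    nlinarith
  rw [this]
  positivity

/-- The true growth is a power of `log n`. The cruder `√n` is preserved by induction on depth and
still leaves the summable majorant `n^(-3/2)`. -/
lemma abs_altMHS_le (l : SignedIndex) (hl : ∀ p ∈ l, 1 ≤ p.1) :
    ∃ C : ℝ, 0 ≤ C ∧ ∀ n, |altMHS l n| ≤ C * √((n : ℝ) + 1) := by
  induction l with
  | nil =>
    refine ⟨1, zero_le_one, fun n => ?_⟩
    simp only [altMHS, abs_one, one_mul]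
    exact Real.one_le_sqrt.2 (by linarith [n.cast_nonneg (α := ℝ)])
  | cons p l ih =>
    obtain ⟨s, σ⟩ := p
    obtain ⟨C, hC, hb⟩ := ih fun p hp => hl p (List.mem_cons_of_mem _ hp)
    have hs : 1 ≤ s := hl (s, σ) List.mem_cons_self
    -- An increment is at most `C / √(n+1) ≤ 2C / √(n+2)`, which is `4C` times the lower bound `1 /
    -- (2√(n+2))` for `√(n+2) - √(n+1)`.
    refine ⟨4 * C, by positivity, fun n => ?_⟩
    induction n with
    | zero => simp [altMHS_zero]; positivity
    | succ n ihn =>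
      rw [altMHS_succ]
      refine (abs_add_le _ _).trans ?_
      have h1 : |((σ : ℤ) : ℝ) ^ (n + 1) / ((n + 1 : ℕ) : ℝ) ^ s * altMHS l n| ≤
          1 / ((n : ℝ) + 1) * (C * √((n : ℝ) + 1)) := by
        rw [abs_mul, abs_div, abs_pow, abs_sign, one_pow, abs_of_nonneg (by positivity)]
        gcongr
        · push_cast
          exact le_self_pow₀ (by linarith [n.cast_nonneg (α := ℝ)]) (by omega)
        · exact hb n
      have h2 : 1 / ((n : ℝ) + 1) * √((n : ℝ) + 1) ≤ 2 / √((n : ℝ) + 2) := by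
        have p1 : 0 < √((n : ℝ) + 1) := Real.sqrt_pos.2 (by positivity)
        have p2 : 0 < √((n : ℝ) + 2) := Real.sqrt_pos.2 (by positivity)
        have h3 : √((n : ℝ) + 1) ^ 2 = n + 1 := Real.sq_sqrt (by positivity)
        have h4 : √((n : ℝ) + 2) ≤ 2 * √((n : ℝ) + 1) := by
          rw [Real.sqrt_le_left (by positivity), mul_pow, h3]
          linarith [n.cast_nonneg (α := ℝ)]
        rw [one_div_mul_eq_div, div_le_div_iff₀ (by positivity) p2]
        nlinarith
      have h5 := sqrt_add_inv_sqrt_le n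
      have h6 : 1 / (2 * √((n : ℝ) + 2)) * 4 = 2 / √((n : ℝ) + 2) := by
        field_simp; norm_num
      have h7 : ((n + 1 : ℕ) : ℝ) + 1 = n + 2 := by push_cast; ring
      rw [h7]
      nlinarith

lemma summable_sqrt_div_sq (C : ℝ) : Summable fun n : ℕ => C * (√((n : ℝ) + 1) / ((n : ℝ) + 1) ^ 2) := by
  have h := (summable_nat_add_iff 1).2 (Real.summable_nat_rpow.2 (by norm_num : (-(3 / 2) : ℝ) < -1))
  refine (h.congr fun n => ?_).mul_left C
  have : (0 : ℝ) < (n : ℝ) + 1 := by positivity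
  push_cast
  rw [Real.sqrt_eq_rpow, ← Real.rpow_natCast, ← Real.rpow_sub this]
  norm_num

lemma tendsto_sqrt_div : Tendsto (fun n : ℕ => √((n : ℝ) + 1) / ((n : ℝ) + 1)) atTop (𝓝 0) := by
  have h : Tendsto (fun n : ℕ => (√((n : ℝ) + 1))⁻¹) atTop (𝓝 0) :=
    (Real.tendsto_sqrt_atTop.comp
      (tendsto_atTop_add_const_right _ 1 tendsto_natCast_atTop_atTop)).inv_tendsto_atTop
  refine h.congr fun n => ?_
  rw [Real.sqrt_div_self']
  simp

/-- Abel summation: twice the alternating sum is an absolutely convergent sum of differences plus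
boundary terms. -/
lemma exists_tendsto_alternating {a : ℕ → ℝ} (h0 : Tendsto a atTop (𝓝 0))
    (hs : Summable fun n => |a (n + 1) - a n|) :
    ∃ x, Tendsto (fun N => ∑ n ∈ Finset.range N, (-1 : ℝ) ^ (n + 1) * a n) atTop (𝓝 x) := by
  have hsum : Summable fun n => (-1 : ℝ) ^ (n + 1) * (a n - a (n + 1)) := by
    refine Summable.of_norm (hs.congr fun n => ?_)
    simp [abs_sub_comm]
  have key : ∀ N, ∑ n ∈ Finset.range N, (-1 : ℝ) ^ (n + 1) * a n =
      (∑ n ∈ Finset.range N, (-1 : ℝ) ^ (n + 1) * (a n - a (n + 1)) - a 0 + (-1) ^ N * a N) / 2 := by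
    intro N
    induction N with
    | zero => simp
    | succ N ih => rw [Finset.sum_range_succ, ih, Finset.sum_range_succ]; ring
  have hb : Tendsto (fun N => (-1 : ℝ) ^ N * a N) atTop (𝓝 0) := by
    refine squeeze_zero_norm (fun N => ?_) (tendsto_norm_zero.comp h0)
    simp
  exact ⟨_, (((hsum.hasSum.tendsto_sum_nat.sub_const (a 0)).add hb).div_const 2).congr
    fun N => (key N).symm⟩

theorem altMZVConverges_cons {s : ℕ} {σ : ℤˣ} {l : SignedIndex} (hs : 1 ≤ s)
    (h : (s, σ) ≠ (1, 1)) (hl : ∀ p ∈ l, 1 ≤ p.1) : AltMZVConverges ((s, σ) :: l) := by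
  obtain ⟨C, hC, hb⟩ := abs_altMHS_le l hl
  unfold AltMZVConverges
  simp only [funext (altMHS_eq_sum_range s σ l)]
  rcases hs.eq_or_lt with rfl | hs
  · obtain rfl : σ = -1 := (Int.units_eq_one_or σ).resolve_left fun h1 => h (by rw [h1])
    -- One step of the inner sum is its last term, bounded by the growth estimate in one depth less;
    -- this makes `altMHS l n / (n + 1)` of bounded variation.
    have hd : ∃ D : ℝ, ∀ n, |altMHS l (n + 1) - altMHS l n| ≤ D * (√((n : ℝ) + 1) / ((n : ℝ) + 1)) := by
      cases l with
      | nil => exact ⟨0, fun n => by simp [altMHS]⟩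
      | cons p l =>
        obtain ⟨t, τ⟩ := p
        obtain ⟨D, hD, hbD⟩ := abs_altMHS_le l fun p hp => hl p (List.mem_cons_of_mem _ hp)
        have ht : 1 ≤ t := hl (t, τ) List.mem_cons_self
        refine ⟨D, fun n => ?_⟩
        rw [altMHS_succ, add_sub_cancel_left, abs_mul, abs_div, abs_pow, abs_sign, one_pow,
          abs_of_nonneg (a := ((n + 1 : ℕ) : ℝ) ^ t) (by positivity)]
        calc 1 / ((n + 1 : ℕ) : ℝ) ^ t * |altMHS l n|
            ≤ 1 / ((n : ℝ) + 1) * (D * √((n : ℝ) + 1)) := by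
              gcongr
              · push_cast
                exact le_self_pow₀ (by linarith [n.cast_nonneg (α := ℝ)]) (by omega)
              · exact hbD n
          _ = _ := by ring
    obtain ⟨D, hd⟩ := hd
    obtain ⟨x, hx⟩ := exists_tendsto_alternating (a := fun n => altMHS l n / ((n : ℝ) + 1))
      (by
        refine squeeze_zero_norm (a := fun n : ℕ => C * (√((n : ℝ) + 1) / ((n : ℝ) + 1)))
          (fun n => ?_) (by simpa using tendsto_sqrt_div.const_mul C)
        rw [norm_div, Real.norm_eq_abs, Real.norm_of_nonneg (by positivity : (0 : ℝ) ≤ n + 1),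
          ← mul_div_assoc]
        gcongr
        exact hb n)
      (by
        refine Summable.of_nonneg_of_le (fun _ => abs_nonneg _) (fun n => ?_)
          (summable_sqrt_div_sq (D + C))
        have p1 : (0 : ℝ) < (n : ℝ) + 1 := by positivity
        have p2 : (0 : ℝ) < (n : ℝ) + 2 := by positivity
        have e : altMHS l (n + 1) / (((n + 1 : ℕ) : ℝ) + 1) - altMHS l n / ((n : ℝ) + 1) =
            (altMHS l (n + 1) - altMHS l n) / ((n : ℝ) + 2) -
              altMHS l n / (((n : ℝ) + 1) * ((n : ℝ) + 2)) := by
          push_cast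
          rw [show (n : ℝ) + 1 + 1 = n + 2 by ring]
          field_simp
          ring
        rw [e]
        refine (abs_sub _ _).trans ?_
        rw [abs_div, abs_div, abs_of_pos p2, abs_of_pos (mul_pos p1 p2)]
        have i1 : |altMHS l (n + 1) - altMHS l n| / ((n : ℝ) + 2) ≤
            D * (√((n : ℝ) + 1) / ((n : ℝ) + 1)) / ((n : ℝ) + 1) :=
          div_le_div₀ ((abs_nonneg _).trans (hd n)) (hd n) p1 (by linarith)
        have i2 : |altMHS l n| / (((n : ℝ) + 1) * ((n : ℝ) + 2)) ≤
            C * √((n : ℝ) + 1) / (((n : ℝ) + 1) * ((n : ℝ) + 1)) :=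
          div_le_div₀ (by positivity) (hb n) (by positivity) (by gcongr; linarith)
        calc _ ≤ _ := add_le_add i1 i2
          _ = _ := by field_simp)
    refine ⟨x, hx.congr fun N => Finset.sum_congr rfl fun n _ => ?_⟩
    push_cast
    ring
  · have : Summable fun n : ℕ => ((σ : ℤ) : ℝ) ^ (n + 1) / ((n + 1 : ℕ) : ℝ) ^ s * altMHS l n := by
      refine Summable.of_norm_bounded (summable_sqrt_div_sq C) fun n => ?_
      rw [Real.norm_eq_abs, abs_mul, abs_div, abs_pow, abs_sign, one_pow,
        abs_of_nonneg (a := ((n + 1 : ℕ) : ℝ) ^ s) (by positivity)]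
      calc 1 / ((n + 1 : ℕ) : ℝ) ^ s * |altMHS l n|
          ≤ 1 / ((n : ℝ) + 1) ^ 2 * (C * √((n : ℝ) + 1)) := by
            gcongr
            · push_cast
              exact pow_le_pow_right₀ (by linarith [n.cast_nonneg (α := ℝ)]) (by omega)
            · exact hb n
        _ = _ := by ring
    exact ⟨_, this.hasSum.tendsto_sum_nat⟩

lemma AltMZVConverges.tendsto {l : SignedIndex} (h : AltMZVConverges l) :
    Tendsto (altMHS l) atTop (𝓝 (altMZV l)) :=
  tendsto_nhds_limUnder h

/-! ### Identities between partial sums. -/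

lemma signedHarmonic_eq (r : ℕ) (σ : ℤˣ) (n : ℕ) :
    signedHarmonic r σ n = ((σ : ℤ) : ℝ) * altMHS [(r, σ)] n := by
  rw [signedHarmonic, sum_Icc_one_eq_sum_range, altMHS_singleton, Finset.mul_sum]
  refine Finset.sum_congr rfl fun m _ => ?_
  rw [pow_succ, ← mul_div_assoc, mul_comm (_ ^ m), ← mul_assoc, sign_mul_self]
  simp

/-- The quasi-shuffle product of two harmonic sums of depth one. -/
lemma altMHS_mul_altMHS (a b : ℕ) (σ τ : ℤˣ) (n : ℕ) :
    altMHS [(a, σ)] n * altMHS [(b, τ)] n =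
      altMHS [(a, σ), (b, τ)] n + altMHS [(b, τ), (a, σ)] n + altMHS [(a + b, σ * τ)] n := by
  induction n with
  | zero => simp [altMHS_zero]
  | succ n ih =>
    simp only [altMHS_succ, add_mul, mul_add, ih]
    simp only [altMHS, Units.val_mul, Int.cast_mul, mul_pow, pow_add]
    field_simp
    ring

lemma eulerPartialSum_succ (l : SignedIndex) (q : ℕ) (τ : ℤˣ) (n : ℕ) :
    eulerPartialSum l q τ (n + 1) = eulerPartialSum l q τ n +
      ((τ : ℤ) : ℝ) ^ n * (l.map fun p => signedHarmonic p.1 p.2 (n + 1)).prod /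
        ((n + 1 : ℕ) : ℝ) ^ q := by
  rw [eulerPartialSum, eulerPartialSum, Finset.sum_Icc_succ_top (by omega)]
  simp

lemma sign_pow_eq (σ : ℤˣ) (n : ℕ) :
    ((σ : ℤ) : ℝ) ^ n = ((σ : ℤ) : ℝ) * ((σ : ℤ) : ℝ) ^ (n + 1) := by
  rw [pow_succ, mul_comm (_ ^ n), ← mul_assoc, sign_mul_self, one_mul]

lemma eulerPartialSum_quadratic (a b q : ℕ) (σ₁ σ₂ σ₃ : ℤˣ) (n : ℕ) :
    eulerPartialSum [(a, σ₁), (b, σ₂)] q σ₃ n =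
      ((σ₁ * σ₂ * σ₃ : ℤˣ) : ℤ) *
        (altMHS [(q, σ₃), (a + b, σ₁ * σ₂)] n + altMHS [(q + a + b, σ₁ * σ₂ * σ₃)] n
          + altMHS [(q, σ₃), (a, σ₁), (b, σ₂)] n + altMHS [(q + a, σ₁ * σ₃), (b, σ₂)] n
          + altMHS [(q, σ₃), (b, σ₂), (a, σ₁)] n + altMHS [(q + b, σ₂ * σ₃), (a, σ₁)] n) := by
  induction n with
  | zero => simp [altMHS_zero, eulerPartialSum]
  | succ n ih =>
    have h := altMHS_mul_altMHS a b σ₁ σ₂ n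
    rw [eulerPartialSum_succ, ih, sign_pow_eq σ₃]
    simp only [List.map_cons, List.map_nil, List.prod_cons, List.prod_nil, signedHarmonic_eq,
      altMHS_succ (q + a), altMHS_succ q, altMHS_succ (q + b), altMHS_succ (q + a + b),
      altMHS_succ a σ₁ [], altMHS_succ b σ₂ []]
    -- The increment contains the product of the two harmonic sums at `n`; eliminating the depth-one
    -- sum of exponent `a + b` turns the goal into a rational identity.
    have h' : altMHS [(a + b, σ₁ * σ₂)] n = altMHS [(a, σ₁)] n * altMHS [(b, σ₂)] n -
      altMHS [(a, σ₁), (b, σ₂)] n - altMHS [(b, σ₂), (a, σ₁)] n := by rw [h]; ring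
    rw [h']
    simp only [altMHS.eq_1, Units.val_mul, Int.cast_mul, mul_pow, pow_add _ q, pow_add _ _ b]
    have : ((n + 1 : ℕ) : ℝ) ≠ 0 := by positivity
    field_simp
    ring

lemma eulerPartialSum_linear (a q : ℕ) (σ τ : ℤˣ) (n : ℕ) :
    eulerPartialSum [(a, σ)] q τ n =
      ((σ * τ : ℤˣ) : ℤ) * (altMHS [(q, τ), (a, σ)] n + altMHS [(q + a, σ * τ)] n) := by
  induction n with
  | zero => simp [altMHS_zero, eulerPartialSum]
  | succ n ih =>
    rw [eulerPartialSum_succ, ih, sign_pow_eq τ]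
    simp only [List.map_cons, List.map_nil, List.prod_cons, List.prod_nil, signedHarmonic_eq,
      altMHS_succ (q + a), altMHS_succ q, altMHS_succ a]
    simp only [altMHS.eq_1, Units.val_mul, Int.cast_mul, mul_pow, pow_add _ q]
    have : ((n + 1 : ℕ) : ℝ) ≠ 0 := by positivity
    field_simp
    ring

/-- With `A` the sum at `n + 1` and `x` its last term, `A³ - (A - x)³ = 3A²x - 3Ax² + x³`: the three
terms are the increments of the quadratic sum, the linear sum and `ζ(3r̄)`, up to sign and the
factor 3. -/
lemma eulerPartialSum_cube (r n : ℕ) :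
    eulerPartialSum [(r, -1), (r, -1)] r (-1) n = eulerPartialSum [(r, -1)] (2 * r) 1 n
      + 1 / 3 * (altMHS [(3 * r, -1)] n - altMHS [(r, -1)] n ^ 3) := by
  induction n with
  | zero => simp [altMHS_zero, eulerPartialSum]
  | succ n ih =>
    rw [eulerPartialSum_succ, ih, eulerPartialSum_succ]
    simp only [List.map_cons, List.map_nil, List.prod_cons, List.prod_nil, signedHarmonic_eq,
      altMHS_succ]
    have e : ((-1 : ℝ) ^ n) ^ 2 = 1 := by rw [← pow_mul, mul_comm, pow_mul]; simp
    rw [mul_comm 2 r, mul_comm 3 r, pow_mul, pow_mul]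
    simp only [altMHS.eq_1, Units.val_neg, Units.val_one, Int.cast_neg, Int.cast_one, one_pow,
      pow_succ (-1 : ℝ) n]
    have : ((n + 1 : ℕ) : ℝ) ≠ 0 := by positivity
    generalize (-1 : ℝ) ^ n = t at *
    field_simp
    have e3 : t ^ 3 = t := by rw [pow_succ, e, one_mul]
    ring_nf
    simp only [e, e3]
    ring

/-! ### Symmetric summation over the nonzero integers. -/

/-- The symmetric partial sum over the nonzero integers of absolute value at most `N`. -/
def symSum (f : ℤ → ℝ) (N : ℕ) : ℝ :=
  ∑ n ∈ Finset.range N, (f ((n : ℤ) + 1) + f (-((n : ℤ) + 1)))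

lemma symSum_succ (f : ℤ → ℝ) (N : ℕ) :
    symSum f (N + 1) = symSum f N + (f ((N : ℤ) + 1) + f (-((N : ℤ) + 1))) :=
  Finset.sum_range_succ _ _

lemma symSum_congr {f g : ℤ → ℝ} (h : ∀ m, m ≠ 0 → f m = g m) : symSum f = symSum g := by
  funext N
  exact Finset.sum_congr rfl fun n _ => by rw [h _ (by omega), h _ (by omega)]

lemma symSum_const_mul (c : ℝ) (f : ℤ → ℝ) (N : ℕ) :
    symSum (fun m => c * f m) N = c * symSum f N := by
  simp only [symSum, Finset.mul_sum, mul_add]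

lemma symSum_add (f g : ℤ → ℝ) (N : ℕ) :
    symSum (fun m => f m + g m) N = symSum f N + symSum g N := by
  simp only [symSum, ← Finset.sum_add_distrib]
  exact Finset.sum_congr rfl fun _ _ => by ring

lemma symSum_sub (f g : ℤ → ℝ) (N : ℕ) :
    symSum (fun m => f m - g m) N = symSum f N - symSum g N := by
  simp only [symSum, ← Finset.sum_sub_distrib]
  exact Finset.sum_congr rfl fun _ _ => by ring

lemma tendsto_symSum_single {k : ℕ} (hk : 1 ≤ k) (c : ℝ) :
    Tendsto (symSum fun m => if m = k then c else 0) atTop (𝓝 c) := by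
  refine tendsto_const_nhds.congr' ?_
  filter_upwards [eventually_ge_atTop k] with N hN
  rw [symSum, Finset.sum_eq_single (k - 1)]
  · rw [if_pos (by omega), if_neg (by omega), add_zero]
  · intro n _ hn
    rw [if_neg (by omega), if_neg (by omega), add_zero]
  · intro h
    exact absurd (Finset.mem_range.2 (by omega)) h

/-- Translating the window costs only end terms, which tend to 0. As the index 0 is omitted, the
shifted sum gains `f 0` and misses `f (-k)`. -/
lemma tendsto_symSum_shift {f : ℤ → ℝ} (hp : Tendsto f atTop (𝓝 0))
    (hn : Tendsto f atBot (𝓝 0)) {x : ℝ} (h : Tendsto (symSum f) atTop (𝓝 x)) (k : ℕ) :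
    Tendsto (symSum fun m => f (m - k)) atTop (𝓝 (x + f 0 - f (-(k : ℤ)))) := by
  induction k with
  | zero => simpa using h
  | succ k ih =>
    have key : ∀ N : ℕ, symSum (fun m => f (m - (k + 1 : ℕ))) N =
        symSum (fun m => f (m - k)) N + f (-(k : ℤ)) - f (-((k + 1 : ℕ) : ℤ))
          + f (-(N : ℤ) + (-(k + 1 : ℤ))) - f ((N : ℤ) + (-k)) := by
      intro N
      induction N with
      | zero =>
        simp only [symSum, Finset.range_zero, Finset.sum_empty]
        push_cast
        ring_nf
      | succ N ihN =>
        rw [symSum_succ, ihN, symSum_succ]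
        push_cast
        rw [show (N : ℤ) + 1 - (k + 1) = N + -k by ring, show (N : ℤ) + 1 - k = N + 1 + -k by ring,
          show -((N : ℤ) + 1) - (k + 1) = -1 + -N + -(k + 1) by ring,
          show -((N : ℤ) + 1) - k = -N + -(k + 1) by ring,
          show -((N : ℤ) + 1) + -(k + 1) = -1 + -N + -(k + 1) by ring]
        ring
    have t1 : Tendsto (fun N : ℕ => f (-(N : ℤ) + (-(k + 1 : ℤ)))) atTop (𝓝 0) :=
      hn.comp (tendsto_atBot_add_const_right _ _
        (tendsto_neg_atTop_atBot.comp tendsto_natCast_atTop_atTop))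
    have t2 : Tendsto (fun N : ℕ => f ((N : ℤ) + (-k))) atTop (𝓝 0) :=
      hp.comp (tendsto_atTop_add_const_right _ _ tendsto_natCast_atTop_atTop)
    have := (((ih.add_const (f (-(k : ℤ)))).sub_const (f (-((k + 1 : ℕ) : ℤ)))).add t1).sub t2
    refine (this.congr fun N => (key N).symm).trans (le_of_eq ?_)
    congr 1
    ring

/-- The terms `(-1) ^ m / m ^ a` over the integers. -/
noncomputable def altPow (a : ℕ) (m : ℤ) : ℝ := (-1 : ℝ) ^ m / (m : ℝ) ^ a

lemma neg_one_zpow_neg (m : ℤ) : (-1 : ℝ) ^ (-m) = (-1 : ℝ) ^ m := by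
  rw [zpow_neg, ← inv_zpow, inv_neg_one]

lemma altPow_neg (a : ℕ) (m : ℤ) : altPow a (-m) = (-1) ^ a * altPow a m := by
  rcases neg_one_pow_eq_or ℝ a with h | h <;>
  · rw [altPow, altPow, neg_one_zpow_neg, Int.cast_neg, neg_pow (m : ℝ), h]
    ring

lemma altPow_natCast (a n : ℕ) : altPow a n = (-1) ^ n / (n : ℝ) ^ a := by
  simp [altPow]

lemma altPow_zero {a : ℕ} (ha : 1 ≤ a) : altPow a 0 = 0 := by
  simp [altPow, show a ≠ 0 by omega]

lemma abs_altPow_le {a : ℕ} (ha : 1 ≤ a) (m : ℤ) : |altPow a m| ≤ |(m : ℝ)|⁻¹ := by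
  rcases eq_or_ne m 0 with rfl | hm
  · simp [altPow_zero ha]
  · have h1 : (1 : ℝ) ≤ |(m : ℝ)| := by exact_mod_cast Int.one_le_abs hm
    rw [altPow, abs_div, abs_zpow, abs_neg, abs_one, one_zpow, abs_pow, one_div]
    exact inv_anti₀ (by linarith) (le_self_pow₀ h1 (by omega))

lemma tendsto_altPow_atTop {a : ℕ} (ha : 1 ≤ a) : Tendsto (altPow a) atTop (𝓝 0) :=
  squeeze_zero_norm (abs_altPow_le ha) (tendsto_inv_atTop_zero.comp
    (tendsto_abs_atTop_atTop.comp tendsto_intCast_atTop_atTop))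

lemma tendsto_altPow_atBot {a : ℕ} (ha : 1 ≤ a) : Tendsto (altPow a) atBot (𝓝 0) := by
  refine squeeze_zero_norm (abs_altPow_le ha) (tendsto_inv_atTop_zero.comp
    (tendsto_abs_atBot_atTop.comp ?_))
  exact tendsto_intCast_atBot_iff.2 tendsto_id

lemma altMZVConverges_bar {a : ℕ} (ha : 1 ≤ a) : AltMZVConverges [(a, -1)] :=
  altMZVConverges_cons ha (by simp) (by simp)

lemma altMZVConverges_single {a : ℕ} (ha : 2 ≤ a) (σ : ℤˣ) : AltMZVConverges [(a, σ)] :=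
  altMZVConverges_cons (by omega) (by simp; omega) (by simp)

lemma altMHS_bar (a n : ℕ) :
    altMHS [(a, -1)] n = ∑ k ∈ Finset.range n, (-1 : ℝ) ^ (k + 1) / ((k + 1 : ℕ) : ℝ) ^ a := by
  simp [altMHS_singleton]

lemma altMHS_unbar (a n : ℕ) :
    altMHS [(a, 1)] n = ∑ k ∈ Finset.range n, 1 / ((k + 1 : ℕ) : ℝ) ^ a := by
  simp [altMHS_singleton]

lemma tendsto_symSum_altPow {a : ℕ} (ha : 1 ≤ a) :
    Tendsto (symSum (altPow a)) atTop (𝓝 ((1 + (-1) ^ a) * altMZV [(a, -1)])) := by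
  refine ((altMZVConverges_bar ha).tendsto.const_mul _).congr fun N => ?_
  rw [altMHS_bar, Finset.mul_sum]
  refine Finset.sum_congr rfl fun n _ => ?_
  rw [altPow_neg, show (n : ℤ) + 1 = (n + 1 : ℕ) by push_cast; rfl, altPow_natCast]
  ring

/-! ### The double series with the sum over `m` innermost. -/

/-- The terms of the double series over `k ≥ 1` and `m ≠ 0, k`. -/
noncomputable def tornheimTerm (a b k : ℕ) (m : ℤ) : ℝ :=
  if m = 0 ∨ m = k then 0 else (-1 : ℝ) ^ ((k : ℤ) - m) / (((k : ℝ) - m) ^ a * (m : ℝ) ^ b)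

/-- Partial fractions: `1 / ((k-m) m) = (1/k) (1/m + 1/(k-m))`. -/
lemma tornheimTerm_succ_succ (a b : ℕ) {k : ℕ} (hk : k ≠ 0) (m : ℤ) :
    tornheimTerm (a + 1) (b + 1) k m =
      (k : ℝ)⁻¹ * (tornheimTerm a (b + 1) k m + tornheimTerm (a + 1) b k m) := by
  unfold tornheimTerm
  split_ifs with h
  · simp
  · push Not at h
    have h1 : (m : ℝ) ≠ 0 := by exact_mod_cast h.1
    have h2 : (k : ℝ) - m ≠ 0 := by
      rw [sub_ne_zero]; exact_mod_cast h.2.symm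
    have h3 : (k : ℝ) ≠ 0 := by exact_mod_cast hk
    field_simp
    ring

lemma tornheimTerm_eq {a : ℕ} (ha : 1 ≤ a) (b k : ℕ) {m : ℤ} (hm : m ≠ 0) :
    tornheimTerm a b k m = altPow a (k - m) / (m : ℝ) ^ b := by
  unfold tornheimTerm
  -- At `m = k` division by zero makes `altPow a 0` vanish when `a ≥ 1`, in agreement with the
  -- excluded term.
  split_ifs with h
  · obtain rfl := h.resolve_left hm
    simp [altPow_zero ha]
  · rw [altPow]
    push_cast
    rw [div_div]

lemma tendsto_symSum_tornheimTerm_right {a k : ℕ} (ha : 1 ≤ a) :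
    Tendsto (symSum (tornheimTerm a 0 k)) atTop
      (𝓝 ((-1) ^ a * ((1 + (-1) ^ a) * altMZV [(a, -1)] - (-1) ^ a * altPow a k))) := by
  have h := (tendsto_symSum_shift (tendsto_altPow_atTop ha) (tendsto_altPow_atBot ha)
    (tendsto_symSum_altPow ha) k).const_mul ((-1) ^ a)
  rw [altPow_zero ha, add_zero, altPow_neg] at h
  refine h.congr fun N => ?_
  rw [← symSum_const_mul]
  refine congrFun (symSum_congr fun m hm => ?_) N
  rw [tornheimTerm_eq ha _ _ hm, ← altPow_neg]
  simp

/-- With exponent 0 on `k - m`, the exclusion of `m = k` is no longer automatic and is the source of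
the subtracted `1 / k ^ b`. -/
lemma tendsto_symSum_tornheimTerm_left {b k : ℕ} (hb : 1 ≤ b) (hk : 1 ≤ k) :
    Tendsto (symSum (tornheimTerm 0 b k)) atTop
      (𝓝 ((-1) ^ k * ((1 + (-1) ^ b) * altMZV [(b, -1)]) - 1 / (k : ℝ) ^ b)) := by
  refine (((tendsto_symSum_altPow hb).const_mul ((-1) ^ k)).sub
    (tendsto_symSum_single hk (1 / (k : ℝ) ^ b))).congr fun N => ?_
  rw [← symSum_const_mul, ← symSum_sub]
  refine congrFun (symSum_congr fun m hm => ?_) N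
  have e : (-1 : ℝ) ^ ((k : ℤ) - m) = (-1) ^ k * (-1 : ℝ) ^ m := by
    rw [sub_eq_add_neg, zpow_add₀ (by norm_num), neg_one_zpow_neg, zpow_natCast]
  unfold tornheimTerm
  by_cases h : m = k
  · subst h
    simp only [or_true, if_true, altPow_natCast, ← mul_div_assoc, ← mul_pow]
    simp
  · rw [if_neg h, if_neg (by tauto), e, altPow]
    simp [mul_div_assoc]

/-- The iterated series with weight `1 / k ^ c` converges to a rational polynomial in zeta values. -/
def TornheimReducible (a b c : ℕ) : Prop :=
  ∃ g : ℕ → ℝ, (∀ k, 1 ≤ k → Tendsto (symSum (tornheimTerm a b k)) atTop (𝓝 (g k))) ∧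
    ∃ x ∈ Algebra.adjoin ℚ altZetaValues,
      Tendsto (fun K => ∑ k ∈ Finset.range K, g (k + 1) / ((k + 1 : ℕ) : ℝ) ^ c) atTop (𝓝 x)

lemma bar_mem {a : ℕ} (ha : 1 ≤ a) : altMZV [(a, -1)] ∈ Algebra.adjoin ℚ altZetaValues :=
  Algebra.subset_adjoin ⟨a, -1, ha, by simp, rfl⟩

lemma unbar_mem {a : ℕ} (ha : 2 ≤ a) : altMZV [(a, 1)] ∈ Algebra.adjoin ℚ altZetaValues :=
  Algebra.subset_adjoin ⟨a, 1, by omega, by simp; omega, rfl⟩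

lemma tornheimReducible_right {a c : ℕ} (ha : 1 ≤ a) (hc : 2 ≤ c) : TornheimReducible a 0 c := by
  refine ⟨_, fun k _ => tendsto_symSum_tornheimTerm_right ha,
    (-1) ^ a * (1 + (-1) ^ a) * altMZV [(a, -1)] * altMZV [(c, 1)] - altMZV [(a + c, -1)], ?_, ?_⟩
  · have h1 : (-1 : ℝ) ∈ Algebra.adjoin ℚ altZetaValues := neg_mem (one_mem _)
    exact sub_mem (mul_mem (mul_mem (mul_mem (pow_mem h1 _) (add_mem (one_mem _) (pow_mem h1 _)))
      (bar_mem ha)) (unbar_mem hc)) (bar_mem (by omega))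
  · refine (((altMZVConverges_single hc 1).tendsto.const_mul _).sub
      (altMZVConverges_bar (by omega : 1 ≤ a + c)).tendsto).congr fun K => ?_
    rw [altMHS_bar, altMHS_unbar, Finset.mul_sum, ← Finset.sum_sub_distrib]
    refine Finset.sum_congr rfl fun k _ => ?_
    rw [altPow_natCast, pow_add _ a c]
    rcases neg_one_pow_eq_or ℝ a with h | h <;> (rw [h]; field_simp <;> ring)

lemma tornheimReducible_left {b c : ℕ} (hb : 1 ≤ b) (hc : 1 ≤ c) : TornheimReducible 0 b c := by
  refine ⟨_, fun k hk => tendsto_symSum_tornheimTerm_left hb hk,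
    (1 + (-1) ^ b) * altMZV [(b, -1)] * altMZV [(c, -1)] - altMZV [(b + c, 1)], ?_, ?_⟩
  · have h1 : (-1 : ℝ) ∈ Algebra.adjoin ℚ altZetaValues := neg_mem (one_mem _)
    exact sub_mem (mul_mem (mul_mem (add_mem (one_mem _) (pow_mem h1 _))
      (bar_mem hb)) (bar_mem hc)) (unbar_mem (by omega))
  · refine (((altMZVConverges_bar hc).tendsto.const_mul _).sub
      (altMZVConverges_single (by omega : 2 ≤ b + c) 1).tendsto).congr fun K => ?_
    rw [altMHS_bar, altMHS_unbar, Finset.mul_sum, ← Finset.sum_sub_distrib]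
    refine Finset.sum_congr rfl fun k _ => ?_
    rw [pow_add _ b c]
    field_simp

/-- Each partial fraction step moves one unit from `a` or `b` to `c`, so the hypotheses persist. At
the ends they give what convergence needs: `c ≥ 1` when `a = 0`, where a factor `(-1)^k` survives,
and `c ≥ 2` when `b = 0`. -/
lemma tornheimReducible (a b c : ℕ) (hab : 1 ≤ a + b) (hac : 1 ≤ c + a) (hbc : 2 ≤ c + b) :
    TornheimReducible a b c := by
  match a, b with
  | 0, b => exact tornheimReducible_left (by omega) (by omega)
  | a + 1, 0 => exact tornheimReducible_right (by omega) (by omega)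
  | a + 1, b + 1 =>
    obtain ⟨g, hg, x, hx, hgx⟩ :=
      tornheimReducible a (b + 1) (c + 1) (by omega) (by omega) (by omega)
    obtain ⟨h, hh, y, hy, hhy⟩ :=
      tornheimReducible (a + 1) b (c + 1) (by omega) (by omega) (by omega)
    refine ⟨fun k => (k : ℝ)⁻¹ * (g k + h k), fun k hk => ?_, x + y, add_mem hx hy, ?_⟩
    · refine (((hg k hk).add (hh k hk)).const_mul _).congr fun N => ?_
      rw [← symSum_add, ← symSum_const_mul]
      exact congrFun (symSum_congr fun m _ => (tornheimTerm_succ_succ a b (by omega) m).symm) N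
    · refine (hgx.add hhy).congr fun K => ?_
      rw [← Finset.sum_add_distrib]
      refine Finset.sum_congr rfl fun k _ => ?_
      have : ((k + 1 : ℕ) : ℝ) ≠ 0 := by positivity
      field_simp
      ring
termination_by a + b

/-! ### The double series with the sum over `k` innermost. -/

/-- The primitive of `m ↦ (-1) ^ m / m ^ r` on the integers, for odd `r`. -/
noncomputable def altPrimitive (r : ℕ) : ℤ → ℝ
  | Int.ofNat n => altMHS [(r, -1)] n
  | Int.negSucc n => altMHS [(r, -1)] n

lemma altPrimitive_natCast (r n : ℕ) : altPrimitive r n = altMHS [(r, -1)] n := rfl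

lemma altPrimitive_neg (r n : ℕ) : altPrimitive r (-((n : ℤ) + 1)) = altMHS [(r, -1)] n := by
  rw [show -((n : ℤ) + 1) = Int.negSucc n by omega]
  rfl

lemma altMHS_bar_succ (r n : ℕ) :
    altMHS [(r, -1)] (n + 1) = altMHS [(r, -1)] n + altPow r ((n : ℤ) + 1) := by
  rw [altMHS_bar, Finset.sum_range_succ, ← altMHS_bar,
    show (n : ℤ) + 1 = (n + 1 : ℕ) by push_cast; rfl, altPow_natCast]

/-- The primitive is symmetric under `z ↦ -1 - z`, which matches `altPow` being odd; the step from
`-1` to `0` adds `altPow r 0 = 0`. -/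
lemma altPrimitive_add_one {r : ℕ} (hr : Odd r) (z : ℤ) :
    altPrimitive r (z + 1) = altPrimitive r z + altPow r (z + 1) := by
  obtain ⟨n, rfl | rfl⟩ : ∃ n : ℕ, z = n ∨ z = -((n : ℤ) + 1) :=
    ⟨if 0 ≤ z then z.toNat else (-z - 1).toNat, by split_ifs <;> omega⟩
  · rw [altPrimitive_natCast, ← altMHS_bar_succ, ← altPrimitive_natCast]
    push_cast
    rfl
  · rw [altPrimitive_neg]
    cases n with
    | zero =>
      have h0 : altPrimitive r (-(((0 : ℕ) : ℤ) + 1) + 1) = altMHS [(r, -1)] 0 := rfl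
      rw [h0]
      simp [altPow_zero hr.pos]
    | succ n =>
      rw [show -(((n + 1 : ℕ) : ℤ) + 1) + 1 = -((n : ℤ) + 1) by push_cast; ring,
        altPrimitive_neg, altPow_neg, hr.neg_one_pow, altMHS_bar_succ]
      ring

lemma sum_tornheimTerm {r : ℕ} (hr : Odd r) (b K : ℕ) {m : ℤ} (hm : m ≠ 0) :
    ∑ k ∈ Finset.range K, tornheimTerm r b (k + 1) m =
      (altPrimitive r (K + -m) - altPrimitive r (-m)) / (m : ℝ) ^ b := by
  induction K with
  | zero => simp
  | succ K ih =>
    rw [Finset.sum_range_succ, ih, tornheimTerm_eq hr.pos _ _ hm,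
      show ((K + 1 : ℕ) : ℤ) + -m = (K + -m) + 1 by push_cast; ring,
      altPrimitive_add_one hr, show ((K + 1 : ℕ) : ℤ) - m = (K + -m) + 1 by push_cast; ring]
    ring

lemma exists_abs_altPrimitive_le {r : ℕ} (hr : 1 ≤ r) : ∃ B, ∀ z, |altPrimitive r z| ≤ B := by
  obtain ⟨B, hB⟩ := (Metric.isBounded_range_of_tendsto _
    (altMZVConverges_bar hr).tendsto).exists_norm_le
  refine ⟨B, fun z => ?_⟩
  cases z <;> exact hB _ ⟨_, rfl⟩

lemma tendsto_altPrimitive {r : ℕ} (hr : 1 ≤ r) (m : ℤ) :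
    Tendsto (fun K : ℕ => altPrimitive r (K + m)) atTop (𝓝 (altMZV [(r, -1)])) := by
  have h : Tendsto (altPrimitive r) atTop (𝓝 (altMZV [(r, -1)])) := by
    have hN : Tendsto Int.toNat atTop atTop :=
      tendsto_atTop_atTop.2 fun b => ⟨b, fun z hz => by omega⟩
    refine ((altMZVConverges_bar hr).tendsto.comp hN).congr' ?_
    filter_upwards [eventually_ge_atTop 0] with z hz
    rw [Function.comp, ← altPrimitive_natCast, Int.toNat_of_nonneg hz]
  exact h.comp (tendsto_atTop_add_const_right _ _ tendsto_natCast_atTop_atTop)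

/-- Summation of the double series in both orders. -/
lemma tendsto_sum_of_tendsto_symSum {r : ℕ} (hr : Odd r) {g : ℕ → ℝ}
    (hg : ∀ k, 1 ≤ k → Tendsto (symSum (tornheimTerm r (2 * r) k)) atTop (𝓝 (g k))) :
    Tendsto (fun K => ∑ k ∈ Finset.range K, g (k + 1)) atTop
      (𝓝 (2 * altMZV [(r, -1)] * altMZV [(2 * r, 1)] - 2 * altMZV [(2 * r, 1), (r, -1)]
        - altMZV [(3 * r, -1)])) := by
  have hr1 : 1 ≤ r := hr.pos
  obtain ⟨B, hB⟩ := exists_abs_altPrimitive_le hr1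
  -- `f K n` sums the terms with `1 ≤ k ≤ K` and `m = ±(n + 1)`, and `F` is its limit in `K`. Four
  -- values of a primitive bounded by `B` give the majorant `4B / (n+1)²`.
  let f : ℕ → ℕ → ℝ := fun K n =>
    (altPrimitive r (K + -((n : ℤ) + 1)) - altPrimitive r (-((n : ℤ) + 1)) +
      (altPrimitive r (K + ((n : ℤ) + 1)) - altPrimitive r ((n : ℤ) + 1))) /
        ((n + 1 : ℕ) : ℝ) ^ (2 * r)
  let F : ℕ → ℝ := fun n =>
    (altMZV [(r, -1)] - altPrimitive r (-((n : ℤ) + 1)) +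
      (altMZV [(r, -1)] - altPrimitive r ((n : ℤ) + 1))) / ((n + 1 : ℕ) : ℝ) ^ (2 * r)
  have hbs : Summable fun n : ℕ => 4 * B * (1 / ((n + 1 : ℕ) : ℝ) ^ 2) :=
    ((summable_nat_add_iff 1).2 (Real.summable_one_div_nat_pow.2 one_lt_two)).mul_left _
  have hf : ∀ K n, ‖f K n‖ ≤ 4 * B * (1 / ((n + 1 : ℕ) : ℝ) ^ 2) := by
    intro K n
    have hn : (1 : ℝ) ≤ ((n + 1 : ℕ) : ℝ) := by exact_mod_cast Nat.succ_pos n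
    rw [norm_div, Real.norm_eq_abs, Real.norm_of_nonneg (by positivity), mul_one_div]
    refine div_le_div₀ (by linarith [(abs_nonneg _).trans (hB 0)]) ?_ (by positivity)
      (pow_le_pow_right₀ hn (by omega))
    have h1 := abs_le.1 (hB (K + -((n : ℤ) + 1)))
    have h2 := abs_le.1 (hB (-((n : ℤ) + 1)))
    have h3 := abs_le.1 (hB (K + ((n : ℤ) + 1)))
    have h4 := abs_le.1 (hB ((n : ℤ) + 1))
    exact abs_le.2 ⟨by linarith, by linarith⟩
  have hfF : ∀ n, Tendsto (f · n) atTop (𝓝 (F n)) := fun n =>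
    (((tendsto_altPrimitive hr1 _).sub_const _).add
      ((tendsto_altPrimitive hr1 _).sub_const _)).div_const _
  have hF : ∀ n, ‖F n‖ ≤ 4 * B * (1 / ((n + 1 : ℕ) : ℝ) ^ 2) := fun n =>
    le_of_tendsto (hfF n).norm (Eventually.of_forall fun K => hf K n)
  have hlim := tendsto_tsum_of_dominated_convergence hbs hfF
    (Eventually.of_forall fun K => hf K)
  have hsumf : ∀ K, ∑' n, f K n = ∑ k ∈ Finset.range K, g (k + 1) := by
    intro K
    refine tendsto_nhds_unique (Summable.of_norm_bounded hbs (hf K)).hasSum.tendsto_sum_nat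
      ((tendsto_finsetSum (Finset.range K) fun k _ => hg (k + 1) (by omega)).congr fun N => ?_)
    simp only [symSum]
    rw [Finset.sum_comm]
    refine Finset.sum_congr rfl fun n _ => ?_
    rw [Finset.sum_add_distrib, sum_tornheimTerm hr _ _ (by omega),
      sum_tornheimTerm hr _ _ (by omega), neg_neg]
    simp only [f]
    push_cast
    rw [Even.neg_pow (even_two_mul r)]
    ring
  have hsumF : ∑' n, F n = 2 * altMZV [(r, -1)] * altMZV [(2 * r, 1)]
      - 2 * altMZV [(2 * r, 1), (r, -1)] - altMZV [(3 * r, -1)] := by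
    have c2 : AltMZVConverges [(2 * r, 1), (r, -1)] :=
      altMZVConverges_cons (by omega) (by simp) (by simpa using hr1)
    refine tendsto_nhds_unique (Summable.of_norm_bounded hbs hF).hasSum.tendsto_sum_nat
      (((((altMZVConverges_single (by omega : 2 ≤ 2 * r) 1).tendsto.const_mul _).sub
        (c2.tendsto.const_mul 2)).sub
          (altMZVConverges_bar (by omega : 1 ≤ 3 * r)).tendsto).congr fun N => ?_)
    -- The primitive is the harmonic sum at `n` for `m = n + 1` and at `n + 1` for `m = -(n + 1)`;
    -- the extra last term of the latter produces `ζ(3r̄)`.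
    rw [altMHS_unbar, altMHS_eq_sum_range, altMHS_bar, Finset.mul_sum, Finset.mul_sum,
      ← Finset.sum_sub_distrib, ← Finset.sum_sub_distrib]
    refine Finset.sum_congr rfl fun n _ => ?_
    simp only [F]
    rw [altPrimitive_neg, show (n : ℤ) + 1 = (n + 1 : ℕ) by push_cast; rfl, altPrimitive_natCast,
      altMHS_bar_succ, show (n : ℤ) + 1 = (n + 1 : ℕ) by push_cast; rfl, altPow_natCast,
      show 3 * r = 2 * r + r by ring, pow_add _ (2 * r) r]
    simp only [Units.val_one, Int.cast_one, one_pow]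
    field_simp
    ring
  rw [hsumF] at hlim
  exact hlim.congr hsumf

theorem altMZV_double_mem {r : ℕ} (hr : Odd r) :
    altMZV [(2 * r, 1), (r, -1)] ∈ Algebra.adjoin ℚ altZetaValues := by
  have hr1 : 1 ≤ r := hr.pos
  obtain ⟨g, hg, x, hx, hgx⟩ := tornheimReducible r (2 * r) 0 (by omega) (by omega) (by omega)
  have h := tendsto_sum_of_tendsto_symSum hr hg
  have hxe := tendsto_nhds_unique (hgx.congr fun K => by simp) h
  have e : altMZV [(2 * r, 1), (r, -1)] = (1 / 2 : ℚ) •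
      (altMZV [(r, -1)] * altMZV [(2 * r, 1)] + altMZV [(r, -1)] * altMZV [(2 * r, 1)]
        - altMZV [(3 * r, -1)] - x) := by
    rw [hxe, Rat.smul_def]
    push_cast
    ring
  rw [e]
  have hm := mul_mem (bar_mem hr1) (unbar_mem (by omega : 2 ≤ 2 * r))
  exact Subalgebra.smul_mem _ (sub_mem (sub_mem (add_mem hm hm) (bar_mem (by omega))) hx) _

/-! ### Passage to the limit for the Euler sums. -/

lemma tendsto_eulerPartialSum_quadratic {a b q : ℕ} {σ₁ σ₂ σ₃ : ℤˣ} (ha : 1 ≤ a) (hb : 1 ≤ b)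
    (hq : 1 ≤ q) (h : (q, σ₃) ≠ (1, 1)) :
    Tendsto (eulerPartialSum [(a, σ₁), (b, σ₂)] q σ₃) atTop
      (𝓝 (((σ₁ * σ₂ * σ₃ : ℤˣ) : ℤ) *
        (altMZV [(q, σ₃), (a + b, σ₁ * σ₂)] + altMZV [(q + a + b, σ₁ * σ₂ * σ₃)]
          + altMZV [(q, σ₃), (a, σ₁), (b, σ₂)] + altMZV [(q + a, σ₁ * σ₃), (b, σ₂)]
          + altMZV [(q, σ₃), (b, σ₂), (a, σ₁)] + altMZV [(q + b, σ₂ * σ₃), (a, σ₁)]))) := by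
  have c1 : AltMZVConverges [(q, σ₃), (a + b, σ₁ * σ₂)] :=
    altMZVConverges_cons hq h (by simp; omega)
  have c2 := altMZVConverges_single (by omega : 2 ≤ q + a + b) (σ₁ * σ₂ * σ₃)
  have c3 : AltMZVConverges [(q, σ₃), (a, σ₁), (b, σ₂)] :=
    altMZVConverges_cons hq h (by simp; omega)
  have c4 : AltMZVConverges [(q + a, σ₁ * σ₃), (b, σ₂)] :=
    altMZVConverges_cons (by omega) (by simp; omega) (by simp; omega)
  have c5 : AltMZVConverges [(q, σ₃), (b, σ₂), (a, σ₁)] :=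
    altMZVConverges_cons hq h (by simp; omega)
  have c6 : AltMZVConverges [(q + b, σ₂ * σ₃), (a, σ₁)] :=
    altMZVConverges_cons (by omega) (by simp; omega) (by simp; omega)
  exact ((((((c1.tendsto.add c2.tendsto).add c3.tendsto).add c4.tendsto).add c5.tendsto).add
    c6.tendsto).const_mul _).congr fun n => (eulerPartialSum_quadratic a b q σ₁ σ₂ σ₃ n).symm

lemma tendsto_eulerPartialSum_linear {r : ℕ} (hr : 1 ≤ r) :
    Tendsto (eulerPartialSum [(r, -1)] (2 * r) 1) atTop
      (𝓝 (-(altMZV [(2 * r, 1), (r, -1)] + altMZV [(3 * r, -1)]))) := by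
  have c1 : AltMZVConverges [(2 * r, 1), (r, -1)] :=
    altMZVConverges_cons (by omega) (by simp) (by simp; omega)
  have c2 := altMZVConverges_bar (by omega : 1 ≤ 3 * r)
  refine (c1.tendsto.add c2.tendsto).neg.congr fun n => ?_
  rw [eulerPartialSum_linear, show 2 * r + r = 3 * r by ring]
  simp

lemma tendsto_eulerPartialSum_cube {r : ℕ} (hr : 1 ≤ r) :
    Tendsto (eulerPartialSum [(r, -1), (r, -1)] r (-1)) atTop
      (𝓝 (eulerSum [(r, -1)] (2 * r) 1
          + 1 / 3 * (altMZV [(3 * r, -1)] - altMZV [(r, -1)] ^ 3))) :=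
  ((tendsto_nhds_limUnder ⟨_, tendsto_eulerPartialSum_linear hr⟩).add
    (((altMZVConverges_bar (by omega : 1 ≤ 3 * r)).tendsto.sub
      ((altMZVConverges_bar hr).tendsto.pow 3)).const_mul _)).congr
    fun n => (eulerPartialSum_cube r n).symm

theorem eulerSum_cube_mem {r : ℕ} (hr : Odd r) :
    eulerSum [(r, -1), (r, -1)] r (-1) ∈ Algebra.adjoin ℚ altZetaValues := by
  have hr1 : 1 ≤ r := hr.pos
  have e : eulerSum [(r, -1), (r, -1)] r (-1) =
      -(altMZV [(2 * r, 1), (r, -1)] + altMZV [(3 * r, -1)]) +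
        (1 / 3 : ℚ) • (altMZV [(3 * r, -1)] - altMZV [(r, -1)] ^ 3) := by
    rw [eulerSum, (tendsto_eulerPartialSum_cube hr1).limUnder_eq, eulerSum,
      (tendsto_eulerPartialSum_linear hr1).limUnder_eq, Rat.smul_def]
    push_cast
    rfl
  rw [e]
  have h3 := bar_mem (by omega : 1 ≤ 3 * r)
  exact add_mem (neg_mem (add_mem (altMZV_double_mem hr) h3))
    (Subalgebra.smul_mem _ (sub_mem h3 (pow_mem (bar_mem hr1) 3)) _)

end EulerSums

theorem mainTheorem12 :
    -- every (alternating) quadratic Euler sum in terms of six alternating MZVs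
    (∀ (i₁ i₂ q : ℕ) (σ₁ σ₂ σ₃ : ℤˣ), 1 ≤ i₁ → 1 ≤ i₂ → 1 ≤ q → (q, σ₃) ≠ (1, 1) →
      EulerSumConverges [(i₁, σ₁), (i₂, σ₂)] q σ₃ ∧
      AltMZVConverges [(q, σ₃), (i₁ + i₂, σ₁ * σ₂)] ∧
      AltMZVConverges [(q + i₁ + i₂, σ₁ * σ₂ * σ₃)] ∧
      AltMZVConverges [(q, σ₃), (i₁, σ₁), (i₂, σ₂)] ∧
      AltMZVConverges [(q + i₁, σ₁ * σ₃), (i₂, σ₂)] ∧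
      AltMZVConverges [(q, σ₃), (i₂, σ₂), (i₁, σ₁)] ∧
      AltMZVConverges [(q + i₂, σ₂ * σ₃), (i₁, σ₁)] ∧
      eulerSum [(i₁, σ₁), (i₂, σ₂)] q σ₃ =
        ((σ₁ * σ₂ * σ₃ : ℤˣ) : ℤ) *
          (altMZV [(q, σ₃), (i₁ + i₂, σ₁ * σ₂)] + altMZV [(q + i₁ + i₂, σ₁ * σ₂ * σ₃)]
            + altMZV [(q, σ₃), (i₁, σ₁), (i₂, σ₂)] + altMZV [(q + i₁, σ₁ * σ₃), (i₂, σ₂)]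
            + altMZV [(q, σ₃), (i₂, σ₂), (i₁, σ₁)] + altMZV [(q + i₂, σ₂ * σ₃), (i₁, σ₁)])) ∧
    -- the reduction of the sums with three equal barred exponents
    (∀ r : ℕ, 1 ≤ r →
      EulerSumConverges [(r, -1), (r, -1)] r (-1) ∧
      EulerSumConverges [(r, -1)] (2 * r) 1 ∧
      AltMZVConverges [(3 * r, -1)] ∧
      AltMZVConverges [(r, -1)] ∧
      eulerSum [(r, -1), (r, -1)] r (-1) =
        eulerSum [(r, -1)] (2 * r) 1
          + 1 / 3 * (altMZV [(3 * r, -1)] - altMZV [(r, -1)] ^ 3)) ∧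
    -- for odd exponents these are rational polynomials in (alternating) zeta values
    (∀ r : ℕ, Odd r →
      eulerSum [(r, -1), (r, -1)] r (-1) ∈ Algebra.adjoin ℚ altZetaValues) := by
  refine ⟨fun a b q σ₁ σ₂ σ₃ ha hb hq h => ?_, fun r hr => ?_, fun r hr => eulerSum_cube_mem hr⟩
  · have hlim := tendsto_eulerPartialSum_quadratic (σ₁ := σ₁) (σ₂ := σ₂) ha hb hq h
    exact ⟨⟨_, hlim⟩, altMZVConverges_cons hq h (by simp; omega),
      altMZVConverges_single (by omega) _, altMZVConverges_cons hq h (by simp; omega),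
      altMZVConverges_cons (by omega) (by simp; omega) (by simp; omega),
      altMZVConverges_cons hq h (by simp; omega),
      altMZVConverges_cons (by omega) (by simp; omega) (by simp; omega), hlim.limUnder_eq⟩
  · exact ⟨⟨_, tendsto_eulerPartialSum_cube hr⟩, ⟨_, tendsto_eulerPartialSum_linear hr⟩,
      altMZVConverges_bar (by omega), altMZVConverges_bar hr,
      (tendsto_eulerPartialSum_cube hr).limUnder_eq⟩
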